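/- Let $n\ge 0$ and let $H_1,H_2$ be $n\times n$ transfer matrices in $\mathcal{RH}_\infty$, i.e. matrices of real rational functions that are proper and have no pole in $\{\operatorname{Re}s\ge 0\}$; write $H_i(\infty)=\lim_{\omega\to\infty}H_i(j\omega)$. For $A\in\mathbb C^{n\times n}$ let $$\hat\alpha_{\max}(A)=\sup_{\|u\|=1,\ Au\neq 0}\arccos\frac{\operatorname{Re}\langle Au,u\rangle}{\|Au\|\,\|u\|}\in[0,\pi],\qquad \hat\alpha_{\max}(0)=0,$$ where $u$ ranges over $\mathbb C^n$ with the Euclidean norm. Suppose that $$\hat\alpha_{\max}(H_1(j\omega))+\hat\alpha_{\max}(H_2(j\omega))<\pi\qquad\text{for every }\omega\in[0,\infty],$$ where $H_i(j\infty)$ means $H_i(\infty)$. Then the negative feedback interconnection $y=H_1e$, $e=u-H_2y$ is $\mathcal L_2$-stable, for signals with values in $F^n$, $F\in\{\mathbb R,\mathbb C\}$: every input $u$ on $[0,\infty)$ that is square integrable on bounded intervals determines signals $e,y$ of the same kind, uniquely up to null sets, and there is $\gamma<\infty$ such that $u\in\mathcal L_2$ implies $e,y\in\mathcal L_2$ with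 $\|e\|\le\gamma\|u\|$ and $\|y\|\le\gamma\|u\|$. Here $H_i$ acts on $\mathcal L_2$ by multiplication of Laplace transforms in the open right half plane, and on locally square integrable signals by causality (truncation). No sectoriality assumption is made. -/

import Mathlib

open MeasureTheory

noncomputable section

namespace SmallPhase

/-! ### Real rational transfer matrices -/

/-- The transfer matrix `H` belongs to `RH∞`: every entry is a real rational function which is
proper and has no pole in the closed right half plane (`num` and `denom` are coprime). -/
def IsRHInfty {n : ℕ} (H : Matrix (Fin n) (Fin n) (RatFunc ℝ)) : Prop :=
  ∀ i j, (H i j).num.natDegree ≤ (H i j).denom.natDegree ∧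
    ∀ s : ℂ, 0 ≤ s.re → Polynomial.aeval s (H i j).denom ≠ 0

/-- The value `H(s)` at a complex number `s` (which is not a pole of `H`). -/
def evalAt {n : ℕ} (H : Matrix (Fin n) (Fin n) (RatFunc ℝ)) (s : ℂ) :
    Matrix (Fin n) (Fin n) ℂ :=
  Matrix.of fun i j => Polynomial.aeval s (H i j).num / Polynomial.aeval s (H i j).denom

/-- The value `H(∞) = lim_{ω → ∞} H(jω)` of a proper `H`: the direct feedthrough matrix. -/
def evalInfty {n : ℕ} (H : Matrix (Fin n) (Fin n) (RatFunc ℝ)) :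
    Matrix (Fin n) (Fin n) ℂ :=
  Matrix.of fun i j =>
    (((H i j).num.coeff (H i j).denom.natDegree / (H i j).denom.leadingCoeff : ℝ) : ℂ)

/-! ### The phase of a square matrix -/

/-- The angles between `u` and `A u`, for unit vectors `u` with `A u ≠ 0`. -/
def phaseSet {n : ℕ} (A : Matrix (Fin n) (Fin n) ℂ) : Set ℝ :=
  {θ | ∃ u : EuclideanSpace ℂ (Fin n), ‖u‖ = 1 ∧ ‖Matrix.toEuclideanCLM (𝕜 := ℂ) A u‖ ≠ 0 ∧
    θ = Real.arccos ((inner ℂ (Matrix.toEuclideanCLM (𝕜 := ℂ) A u) u).re /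
      (‖Matrix.toEuclideanCLM (𝕜 := ℂ) A u‖ * ‖u‖))}

/-- The maximum phase: the supremum of the angles in `phaseSet A`, a subset of `[0, π]`. It is `0`
if `A = 0`, since `sSup ∅ = 0`. -/
def maxPhase {n : ℕ} (A : Matrix (Fin n) (Fin n) ℂ) : ℝ := sSup (phaseSet A)

/-! ### Signals on the half line `[0, ∞)`

A signal is a function on `ℝ` of which only the restriction to `[0, ∞)` matters. -/

section Signals

variable {𝕜 : Type*} [RCLike 𝕜] {n : ℕ}

/-- Lebesgue measure on the time axis `[0, ∞)`. -/
def timeMeasure : Measure ℝ := volume.restrict (Set.Ici 0)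

/-- `u ∈ L₂ⁿ(𝕜)`. -/
def IsL2 (u : ℝ → EuclideanSpace 𝕜 (Fin n)) : Prop := MemLp u 2 timeMeasure

/-- The extended space `L₂ₑⁿ(𝕜)`: signals which are square integrable on every `[0, T]`. -/
def IsL2e (u : ℝ → EuclideanSpace 𝕜 (Fin n)) : Prop :=
  ∀ T : ℝ, MemLp u 2 (volume.restrict (Set.Icc 0 T))

/-- The Laplace transform `û(s) = ∫₀^∞ e^{-st} u(t) dt`. -/
def laplace (u : ℝ → EuclideanSpace 𝕜 (Fin n)) (s : ℂ) : Fin n → ℂ :=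
  fun i => ∫ t, Complex.exp (-(s * (t : ℂ))) * RCLike.map 𝕜 ℂ (u t i) ∂timeMeasure

/-- The truncation of a signal to `[0, T]`. -/
def truncate (T : ℝ) (u : ℝ → EuclideanSpace 𝕜 (Fin n)) : ℝ → EuclideanSpace 𝕜 (Fin n) :=
  (Set.Icc 0 T).indicator u

/-- For `u ∈ L₂`: the signal `y ∈ L₂` is the response `H u` of the system with transfer matrix `H`,
that is, `ŷ(s) = H(s) û(s)` in the open right half plane. -/
def IsL2Response (H : Matrix (Fin n) (Fin n) (RatFunc ℝ))
    (u y : ℝ → EuclideanSpace 𝕜 (Fin n)) : Prop :=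
  IsL2 y ∧ ∀ s : ℂ, 0 < s.re → laplace y s = (evalAt H s).mulVec (laplace u s)

/-- For `u ∈ L₂ₑ`: the signal `y` is the response `H u`, where the causal operator `H` on `L₂` is
extended to `L₂ₑ` by truncation: on every `[0, T]`, `y` agrees with the response to the
truncation of `u` to `[0, T]`. -/
def IsResponse (H : Matrix (Fin n) (Fin n) (RatFunc ℝ))
    (u y : ℝ → EuclideanSpace 𝕜 (Fin n)) : Prop :=
  ∀ T : ℝ, ∃ z : ℝ → EuclideanSpace 𝕜 (Fin n),
    IsL2Response H (truncate T u) z ∧ y =ᵐ[volume.restrict (Set.Icc 0 T)] z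

/-- The signals `e, y ∈ L₂ₑ` solve the negative feedback interconnection of `H₁` (forward path) and
`H₂` (feedback path) with external input `u`: `y = H₁ e` and `e = u - H₂ y`. -/
def IsLoopSolution (H₁ H₂ : Matrix (Fin n) (Fin n) (RatFunc ℝ))
    (u e y : ℝ → EuclideanSpace 𝕜 (Fin n)) : Prop :=
  IsL2e e ∧ IsL2e y ∧ IsResponse H₁ e y ∧
    ∃ w : ℝ → EuclideanSpace 𝕜 (Fin n), IsL2e w ∧ IsResponse H₂ y w ∧
      e =ᵐ[timeMeasure] fun t => u t - w t

end Signals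

/-- The negative feedback interconnection of `H₁` and `H₂` is `L₂`-stable (for signals with values
in `𝕜ⁿ`): every input `u ∈ L₂ₑ` determines the loop signals `e, y ∈ L₂ₑ`, uniquely up to null sets,
and every input `u ∈ L₂` produces `e, y ∈ L₂`, with a finite gain. -/
structure IsL2Stable (𝕜 : Type*) [RCLike 𝕜] {n : ℕ}
    (H₁ H₂ : Matrix (Fin n) (Fin n) (RatFunc ℝ)) : Prop where
  exists_solution : ∀ u : ℝ → EuclideanSpace 𝕜 (Fin n), IsL2e u →
    ∃ e y, IsLoopSolution H₁ H₂ u e y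
  unique_solution : ∀ u e y e' y' : ℝ → EuclideanSpace 𝕜 (Fin n), IsL2e u →
    IsLoopSolution H₁ H₂ u e y → IsLoopSolution H₁ H₂ u e' y' →
      e =ᵐ[timeMeasure] e' ∧ y =ᵐ[timeMeasure] y'
  finite_gain : ∃ γ : NNReal, ∀ u e y : ℝ → EuclideanSpace 𝕜 (Fin n), IsL2 u →
    IsLoopSolution H₁ H₂ u e y →
      IsL2 e ∧ IsL2 y ∧ eLpNorm e 2 timeMeasure ≤ γ * eLpNorm u 2 timeMeasure ∧
        eLpNorm y 2 timeMeasure ≤ γ * eLpNorm u 2 timeMeasure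

end SmallPhase

end

/-!
Suppose `I + τ H₂ H₁` had a null vector `u` at some point of the extended imaginary axis, for some
`0 < τ ≤ 1`. With `x = H₁ u` this says `H₂ x = -u / τ`, so the vectors `u` and `H₂ x` enclose the
angle `π`, although the triangle inequality for angles through `x` bounds it by the sum of the two
maximal phases. Hence `det (I + τ H₂ H₁)` does not vanish on the extended axis for `0 ≤ τ ≤ 1`, and
for each such `τ` compactness bounds it away from `0` there. Its invertibility in `RH∞` is an open
condition on `τ`. It is also a closed one, because Phragmén–Lindelöf, applied to the inverse at
nearby parameters, carries the lower bound from the axis to the whole half plane. As it holds at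
`τ = 0`, it holds at `τ = 1`: the matrix `R = (I + H₂ H₁)⁻¹` has entries in `RH∞`.

By partial fractions a function in `RH∞` is a constant plus the Laplace transform of an integrable
function on the half line, so multiplication by it is a causal convolution operator, bounded on `L₂`
by Young's inequality. Since the Laplace transform determines an `L₂` signal, identities between
transfer matrices are identities between these operators; the loop is solved by `e = R u` and
`y = H₁ R u`.
-/

noncomputable section

namespace SmallPhase

open Bornology Filter Polynomial Topology
open scoped BoundedContinuousFunction ComplexConjugate ENNReal FourierTransform NNReal SchwartzMap

section Phase

variable {n : ℕ}

lemma angle_le_maxPhase (A : Matrix (Fin n) (Fin n) ℂ) {u : EuclideanSpace ℂ (Fin n)}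
    (hu : Matrix.toEuclideanCLM (𝕜 := ℂ) A u ≠ 0) :
    letI := InnerProductSpace.rclikeToReal ℂ (EuclideanSpace ℂ (Fin n))
    InnerProductGeometry.angle (Matrix.toEuclideanCLM (𝕜 := ℂ) A u) u ≤ maxPhase A := by
  let _ := InnerProductSpace.rclikeToReal ℂ (EuclideanSpace ℂ (Fin n))
  have hu0 : u ≠ 0 := fun h => hu (by rw [h, map_zero])
  have hr : 0 < ‖u‖⁻¹ := inv_pos.2 (norm_pos_iff.2 hu0)
  have hAu : Matrix.toEuclideanCLM (𝕜 := ℂ) A (‖u‖⁻¹ • u) =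
      ‖u‖⁻¹ • Matrix.toEuclideanCLM (𝕜 := ℂ) A u := map_smul _ ((‖u‖⁻¹ : ℝ) : ℂ) u
  refine le_csSup ⟨Real.pi, ?_⟩ ⟨‖u‖⁻¹ • u, ?_, ?_, ?_⟩
  · rintro θ ⟨v, -, -, rfl⟩
    exact Real.arccos_le_pi _
  · rw [norm_smul, norm_inv, norm_norm, inv_mul_cancel₀ (norm_ne_zero_iff.2 hu0)]
  · rw [hAu]
    exact norm_ne_zero_iff.2 (smul_ne_zero hr.ne' hu)
  · rw [← InnerProductGeometry.angle_smul_left_of_pos _ _ hr,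
      ← InnerProductGeometry.angle_smul_right_of_pos _ _ hr, ← hAu]
    rfl

lemma det_one_add_smul_mul_ne_zero {A B : Matrix (Fin n) (Fin n) ℂ}
    (h : maxPhase A + maxPhase B < Real.pi) {τ : ℝ} (hτ : 0 ≤ τ) :
    (1 + τ • (B * A)).det ≠ 0 := by
  intro hdet
  let _ := InnerProductSpace.rclikeToReal ℂ (EuclideanSpace ℂ (Fin n))
  obtain ⟨v, hv0, hv⟩ := Matrix.exists_mulVec_eq_zero_iff.2 hdet
  set u : EuclideanSpace ℂ (Fin n) := WithLp.toLp 2 v with hu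
  set x := Matrix.toEuclideanCLM (𝕜 := ℂ) A u with hx
  set y := Matrix.toEuclideanCLM (𝕜 := ℂ) B x with hy
  have hu0 : u ≠ 0 := by simpa [hu] using hv0
  have huy : u = (-τ) • y := by
    rw [hy, hx, hu, Matrix.toEuclideanCLM_toLp, Matrix.toEuclideanCLM_toLp, ← WithLp.toLp_smul,
      Matrix.mulVec_mulVec, neg_smul]
    rw [Matrix.add_mulVec, Matrix.one_mulVec, Matrix.smul_mulVec] at hv
    exact congrArg _ (eq_neg_of_add_eq_zero_left hv)
  have hy0 : y ≠ 0 := fun h0 => hu0 (by rw [huy, h0, smul_zero])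
  have hx0 : x ≠ 0 := fun h0 => hy0 (by rw [hy, h0, map_zero])
  have hτ0 : 0 < τ := hτ.lt_of_ne fun h0 => hu0 (by rw [huy, ← h0, neg_zero, zero_smul])
  refine h.not_ge ?_
  calc Real.pi = InnerProductGeometry.angle y u := by
        rw [huy, InnerProductGeometry.angle_smul_right_of_neg _ _ (neg_lt_zero.2 hτ0),
          InnerProductGeometry.angle_neg_right, InnerProductGeometry.angle_self hy0, sub_zero]
    _ ≤ InnerProductGeometry.angle y x + InnerProductGeometry.angle x u :=
        InnerProductGeometry.angle_le_angle_add_angle y x u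
    _ ≤ maxPhase A + maxPhase B := by
        rw [add_comm]
        exact add_le_add (angle_le_maxPhase A hx0) (angle_le_maxPhase B hy0)

end Phase

section RHInfty

/-- The ring `RH∞` of real rational functions which are proper and have no pole in the closed right
half plane. -/
def rhInfty : Subalgebra ℝ (RatFunc ℝ) where
  carrier := {f | f.num.natDegree ≤ f.denom.natDegree ∧ ∀ s : ℂ, 0 ≤ s.re → aeval s f.denom ≠ 0}
  add_mem' := by
    rintro f g ⟨hf, hf'⟩ ⟨hg, hg'⟩
    refine ⟨?_, fun s hs h0 => ?_⟩
    · rcases eq_or_ne g 0 with rfl | hg0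
      · rwa [add_zero]
      rcases eq_or_ne (f + g) 0 with h0 | h0
      · simp [h0]
      have := RatFunc.intDegree_add_le hg0 h0
      simp only [RatFunc.intDegree] at this
      omega
    · have := map_dvd (aeval s) (RatFunc.denom_add_dvd f g)
      rw [h0, zero_dvd_iff, map_mul] at this
      exact mul_ne_zero (hf' s hs) (hg' s hs) this
  mul_mem' := by
    rintro f g ⟨hf, hf'⟩ ⟨hg, hg'⟩
    refine ⟨?_, fun s hs h0 => ?_⟩
    · rcases eq_or_ne f 0 with rfl | hf0
      · simp
      rcases eq_or_ne g 0 with rfl | hg0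
      · simp
      have := RatFunc.intDegree_mul hf0 hg0
      simp only [RatFunc.intDegree] at this
      omega
    · have := map_dvd (aeval s) (RatFunc.denom_mul_dvd f g)
      rw [h0, zero_dvd_iff, map_mul] at this
      exact mul_ne_zero (hf' s hs) (hg' s hs) this
  algebraMap_mem' c := by
    rw [RatFunc.algebraMap_eq_C]
    simp

lemma tendsto_aeval_div_aeval_cobounded {p q : ℝ[X]} (hq : q ≠ 0)
    (hpq : p.natDegree ≤ q.natDegree) :
    Tendsto (fun s : ℂ => aeval s p / aeval s q) (cobounded ℂ)
      (𝓝 ((p.coeff q.natDegree / q.leadingCoeff : ℝ) : ℂ)) := by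
  set c : ℝ := p.coeff q.natDegree / q.leadingCoeff with hc
  have hdeg : (p - C c * q).degree < q.degree := by
    rw [degree_eq_natDegree hq, degree_lt_iff_coeff_zero]
    intro m hm
    rcases hm.eq_or_lt with rfl | hm
    · rw [coeff_sub, coeff_C_mul, coeff_natDegree, hc,
        div_mul_cancel₀ _ (leadingCoeff_ne_zero.2 hq), sub_self]
    · rw [coeff_sub, coeff_C_mul, coeff_eq_zero_of_natDegree_lt hm,
        coeff_eq_zero_of_natDegree_lt (hpq.trans_lt hm), mul_zero, sub_self]
  have hlim : Tendsto (fun s : ℂ => aeval s (p - C c * q) / aeval s q) (cobounded ℂ) (𝓝 0) := by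
    have h := isLittleO_cobounded_of_degree_lt (P := (p - C c * q).map (algebraMap ℝ ℂ))
      (Q := q.map (algebraMap ℝ ℂ)) (by rwa [degree_map, degree_map])
    simpa only [eval_map_algebraMap] using h.tendsto_div_nhds_zero
  have hne : ∀ᶠ s in cobounded ℂ, aeval s q ≠ 0 := by
    have h := (eventually_cofinite_not_isRoot (map_ne_zero (f := algebraMap ℝ ℂ) hq)).filter_mono
      (le_cofinite ℂ)
    simpa only [IsRoot, eval_map_algebraMap] using h
  rw [← zero_add ((c : ℝ) : ℂ)]
  refine (hlim.add_const (c : ℂ)).congr' (hne.mono fun s hs => ?_)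
  rw [map_sub, map_mul, aeval_C, sub_div, mul_div_cancel_right₀ _ hs]
  exact sub_add_cancel _ _

/-- The closed right half plane. -/
abbrev ClosedRHP : Type := {s : ℂ // 0 ≤ s.re}

/-- The point `jω` of the imaginary axis. -/
def axisPoint (ω : ℝ) : ClosedRHP := ⟨Complex.I * ω, by simp⟩

/-- The value at a point of the closed right half plane, as a homomorphism on `RH∞`. -/
def evalHom (s : ClosedRHP) : rhInfty →ₐ[ℝ] ℂ where
  toFun f := f.1.eval (algebraMap ℝ ℂ) s
  map_zero' := RatFunc.eval_zero _ _
  map_one' := RatFunc.eval_one _ _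
  map_add' f g := RatFunc.eval_add (algebraMap ℝ ℂ) (s : ℂ) (f.2.2 s s.2) (g.2.2 s s.2)
  map_mul' f g := RatFunc.eval_mul (algebraMap ℝ ℂ) (s : ℂ) (f.2.2 s s.2) (g.2.2 s s.2)
  commutes' r := (RatFunc.eval_algebraMap (algebraMap ℝ ℂ) (s : ℂ) r).trans (eval₂_C _ _)

lemma evalHom_apply (s : ClosedRHP) (f : rhInfty) :
    evalHom s f = aeval (s : ℂ) f.1.num / aeval (s : ℂ) f.1.denom := rfl

lemma continuous_evalHom (f : rhInfty) : Continuous fun s => evalHom s f := by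
  simp only [evalHom_apply]
  exact (f.1.num.continuous_aeval.comp continuous_subtype_val).div
    (f.1.denom.continuous_aeval.comp continuous_subtype_val) fun s => f.2.2 s s.2

/-- The value at infinity `f(∞) = lim_{ω → ∞} f(jω)` of `f ∈ RH∞`. -/
def valueInfty (f : rhInfty) : ℂ :=
  ((f.1.num.coeff f.1.denom.natDegree / f.1.denom.leadingCoeff : ℝ) : ℂ)

lemma tendsto_evalHom_comap_cobounded (f : rhInfty) :
    Tendsto (fun s => evalHom s f) (comap Subtype.val (cobounded ℂ)) (𝓝 (valueInfty f)) :=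
  (tendsto_aeval_div_aeval_cobounded f.1.denom_ne_zero f.2.1).comp tendsto_comap

lemma tendsto_axisPoint_cocompact :
    Tendsto axisPoint (cocompact ℝ) (comap Subtype.val (cobounded ℂ)) := by
  rw [tendsto_comap_iff, ← tendsto_norm_atTop_iff_cobounded]
  exact tendsto_norm_cocompact_atTop.congr fun ω => by simp [axisPoint]

lemma tendsto_evalHom_axisPoint (f : rhInfty) :
    Tendsto (fun ω => evalHom (axisPoint ω) f) (cocompact ℝ) (𝓝 (valueInfty f)) :=
  (tendsto_evalHom_comap_cobounded f).comp tendsto_axisPoint_cocompact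

/-- The value at infinity, as a homomorphism on `RH∞`. -/
def evalInftyHom : rhInfty →ₐ[ℝ] ℂ :=
  AlgHom.ofLinearMap
    { toFun := valueInfty
      map_add' := fun f g => tendsto_nhds_unique (tendsto_evalHom_axisPoint (f + g)) <| by
        simpa only [map_add] using (tendsto_evalHom_axisPoint f).add (tendsto_evalHom_axisPoint g)
      map_smul' := fun r f => tendsto_nhds_unique (tendsto_evalHom_axisPoint (r • f)) <| by
        simpa only [map_smul, RingHom.id_apply] using (tendsto_evalHom_axisPoint f).const_smul r }
    (tendsto_nhds_unique (tendsto_evalHom_axisPoint 1) <| by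
      simpa only [map_one] using tendsto_const_nhds)
    fun f g => tendsto_nhds_unique (tendsto_evalHom_axisPoint (f * g)) <| by
      simp only [map_mul]
      exact (tendsto_evalHom_axisPoint f).mul (tendsto_evalHom_axisPoint g)

lemma evalInftyHom_apply (f : rhInfty) : evalInftyHom f = valueInfty f := rfl

lemma exists_norm_evalHom_le (f : rhInfty) : ∃ C, ∀ s, ‖evalHom s f‖ ≤ C := by
  have hlim := (tendsto_evalHom_comap_cobounded f).norm.eventually_le_const (lt_add_one _)
  obtain ⟨r, -, hr⟩ := (Metric.hasBasis_cobounded_compl_closedBall (0 : ℂ)).comap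
    (Subtype.val : ClosedRHP → ℂ) |>.eventually_iff.1 hlim
  have hK : IsCompact ((Subtype.val : ClosedRHP → ℂ) ⁻¹' Metric.closedBall 0 r) :=
    (isClosed_le continuous_const Complex.continuous_re).isClosedEmbedding_subtypeVal
      |>.isCompact_preimage (isCompact_closedBall 0 r)
  obtain ⟨C, hC⟩ := hK.exists_bound_of_continuousOn (continuous_evalHom f).continuousOn
  refine ⟨max C (‖valueInfty f‖ + 1), fun s => ?_⟩
  by_cases hs : (s : ℂ) ∈ Metric.closedBall 0 r
  · exact (hC s hs).trans (le_max_left _ _)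
  · exact (hr hs).trans (le_max_right _ _)

/-- The functions in `RH∞` as bounded continuous functions on the closed right half plane. -/
def toBCF : rhInfty →ₐ[ℝ] (ClosedRHP →ᵇ ℂ) where
  toFun f := .ofNormedAddCommGroup (fun s => evalHom s f) (continuous_evalHom f) _
    (exists_norm_evalHom_le f).choose_spec
  map_zero' := by ext s; exact map_zero (evalHom s)
  map_one' := by ext s; exact map_one (evalHom s)
  map_add' f g := by ext s; exact map_add (evalHom s) f g
  map_mul' f g := by ext s; exact map_mul (evalHom s) f g
  commutes' r := by ext s; exact (evalHom s).commutes r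

lemma isUnit_of_evalHom_ne_zero {f : rhInfty} (hf : ∀ s, evalHom s f ≠ 0)
    (hf' : valueInfty f ≠ 0) : IsUnit f := by
  have hf0 : f.1 ≠ 0 := fun h0 => hf (axisPoint 0) (by
    rw [show f = 0 from Subtype.ext h0, map_zero])
  have hmem : f.1⁻¹ ∈ rhInfty := by
    refine ⟨?_, fun s hs h0 => ?_⟩
    · have hcoeff : f.1.num.coeff f.1.denom.natDegree ≠ 0 := fun h0 =>
        hf' (by rw [valueInfty, h0, zero_div, Complex.ofReal_zero])
      have hle := le_natDegree_of_ne_zero hcoeff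
      have hdeg := RatFunc.intDegree_inv f.1
      simp only [RatFunc.intDegree] at hdeg
      omega
    · have hnum := map_dvd (aeval s) (RatFunc.denom_inv_dvd hf0)
      rw [h0, zero_dvd_iff] at hnum
      exact hf ⟨s, hs⟩ (by rw [evalHom_apply, hnum, zero_div])
  exact IsUnit.of_mul_eq_one ⟨f.1⁻¹, hmem⟩ (Subtype.ext (mul_inv_cancel₀ hf0))

lemma isUnit_of_isUnit_toBCF {f : rhInfty} (hf : IsUnit (toBCF f)) : IsUnit f := by
  obtain ⟨g, hg⟩ := hf.exists_right_inv
  have hfg (s : ClosedRHP) : evalHom s f * g s = 1 := DFunLike.congr_fun hg s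
  refine isUnit_of_evalHom_ne_zero (fun s => left_ne_zero_of_mul_eq_one (hfg s)) fun h0 => ?_
  have hlim : Tendsto (fun ω => evalHom (axisPoint ω) f * g (axisPoint ω)) (cocompact ℝ) (𝓝 0) :=
    Tendsto.zero_mul_isBoundedUnder_le (by simpa only [h0] using tendsto_evalHom_axisPoint f)
      (isBoundedUnder_of ⟨‖g‖, fun ω => g.norm_coe_le_norm _⟩)
  simp only [hfg] at hlim
  exact one_ne_zero (tendsto_nhds_unique tendsto_const_nhds hlim)

lemma diffContOnCl_aeval_num_div_aeval_denom (f : rhInfty) :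
    DiffContOnCl ℂ (fun s : ℂ => aeval s f.1.num / aeval s f.1.denom) {s | 0 < s.re} := by
  refine DifferentiableOn.diffContOnCl fun s hs => ?_
  rw [Complex.closure_setOfPred_lt_re] at hs
  exact (f.1.num.differentiable_aeval s |>.div (f.1.denom.differentiable_aeval s)
    (f.2.2 s hs)).differentiableWithinAt

lemma norm_evalHom_le_of_axis {f : rhInfty} {C : ℝ} (hC : ∀ ω, ‖evalHom (axisPoint ω) f‖ ≤ C)
    (s : ClosedRHP) : ‖evalHom s f‖ ≤ C := by
  obtain ⟨K, hK⟩ := exists_norm_evalHom_le f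
  refine PhragmenLindelof.right_half_plane_of_bounded_on_real
    (diffContOnCl_aeval_num_div_aeval_denom f) ⟨0, two_pos, 0, ?_⟩ ⟨K, ?_⟩ (fun ω => ?_) s.2
  · refine Asymptotics.IsBigO.of_bound K ?_
    filter_upwards [mem_inf_of_right (mem_principal_self _)] with z hz
    simp only [zero_mul, Real.exp_zero, norm_one, mul_one]
    exact hK ⟨z, le_of_lt hz⟩
  · exact (eventually_ge_atTop (0 : ℝ)).mono fun x hx => hK ⟨x, hx⟩
  · rw [mul_comm]
    exact hC ω

lemma le_norm_evalHom_of_axis {f : rhInfty} (hf : IsUnit f) {δ : ℝ} (hδ : 0 < δ)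
    (haxis : ∀ ω, δ ≤ ‖evalHom (axisPoint ω) f‖) (s : ClosedRHP) : δ ≤ ‖evalHom s f‖ := by
  obtain ⟨g, hfg⟩ := hf.exists_right_inv
  have hnorm (s : ClosedRHP) : ‖evalHom s f‖ * ‖evalHom s g‖ = 1 := by
    rw [← norm_mul, ← map_mul, hfg, map_one, norm_one]
  have hg : ‖evalHom s g‖ ≤ δ⁻¹ := norm_evalHom_le_of_axis (fun ω => by
    rw [eq_inv_of_mul_eq_one_right (hnorm (axisPoint ω))]
    exact inv_anti₀ hδ (haxis ω)) s
  rw [eq_inv_of_mul_eq_one_left (hnorm s)]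
  exact (le_inv_comm₀ hδ (norm_pos_iff.2 fun h0 => by simpa [h0] using hnorm s)).2 hg

lemma exists_pos_le_norm_evalHom_axisPoint {f : rhInfty} (hf : ∀ ω, evalHom (axisPoint ω) f ≠ 0)
    (hf' : valueInfty f ≠ 0) : ∃ δ > 0, ∀ ω, δ ≤ ‖evalHom (axisPoint ω) f‖ := by
  have hv : 0 < ‖valueInfty f‖ / 2 := half_pos (norm_pos_iff.2 hf')
  have hcont : Continuous fun ω => min ‖evalHom (axisPoint ω) f‖ (‖valueInfty f‖ / 2) :=
    ((continuous_evalHom f).comp (Continuous.subtype_mk (by fun_prop) _)).norm.min continuous_const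
  have hlarge := (tendsto_evalHom_axisPoint f).norm.eventually_const_le
    (half_lt_self (norm_pos_iff.2 hf'))
  obtain ⟨ω₀, hω₀⟩ := hcont.exists_forall_le' 0 <| hlarge.mono fun ω hω => by
    rw [min_eq_right hω]
    exact min_le_right _ _
  exact ⟨_, lt_min (norm_pos_iff.2 (hf ω₀)) hv, fun ω => (hω₀ ω).trans (min_le_left _ _)⟩

lemma isUnit_of_norm_toBCF_sub_lt {f g : rhInfty} (hg : IsUnit g) {δ : ℝ}
    (haxis : ∀ ω, δ ≤ ‖evalHom (axisPoint ω) f‖) (hfg : ‖toBCF f - toBCF g‖ < δ / 2)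
    (hinf : valueInfty f ≠ 0) : IsUnit f := by
  have hclose (s : ClosedRHP) : ‖evalHom s f - evalHom s g‖ < δ / 2 :=
    ((toBCF f - toBCF g).norm_coe_le_norm s).trans_lt hfg
  have hg_axis (ω : ℝ) : δ / 2 ≤ ‖evalHom (axisPoint ω) g‖ := by
    linarith [haxis ω, hclose (axisPoint ω),
      norm_sub_norm_le (evalHom (axisPoint ω) f) (evalHom (axisPoint ω) g)]
  refine isUnit_of_evalHom_ne_zero (fun s h0 => ?_) hinf
  have hs := hclose s
  rw [h0, zero_sub, norm_neg] at hs
  exact hs.not_ge (le_norm_evalHom_of_axis hg ((norm_nonneg _).trans_lt hfg) hg_axis s)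

theorem isUnit_of_homotopy {D : ℝ → rhInfty} (hD : Continuous fun t => toBCF (D t))
    (h0 : IsUnit (D 0)) (haxis : ∀ t ∈ Set.Icc (0 : ℝ) 1, ∀ ω, evalHom (axisPoint ω) (D t) ≠ 0)
    (hinf : ∀ t ∈ Set.Icc (0 : ℝ) 1, valueInfty (D t) ≠ 0) : IsUnit (D 1) := by
  have hiff (t : ℝ) : IsUnit (toBCF (D t)) ↔ IsUnit (D t) :=
    ⟨isUnit_of_isUnit_toBCF, fun h => h.map toBCF⟩
  have hopen : IsOpen {t | IsUnit (D t)} := by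
    simp only [← hiff]
    exact Units.isOpen.preimage hD
  have hclosed : closure {t | IsUnit (D t)} ∩ Set.Icc 0 1 ⊆ {t | IsUnit (D t)} := by
    rintro t ⟨htc, ht⟩
    obtain ⟨δ, hδ, hδ'⟩ := exists_pos_le_norm_evalHom_axisPoint (haxis t ht) (hinf t ht)
    have hnear : ∀ᶠ τ in 𝓝 t, ‖toBCF (D t) - toBCF (D τ)‖ < δ / 2 :=
      ((continuous_const.sub hD).norm.tendsto' t 0 (by simp)).eventually_lt_const (half_pos hδ)
    obtain ⟨τ, hτ, hτt⟩ := ((mem_closure_iff_frequently.1 htc).and_eventually hnear).exists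
    exact isUnit_of_norm_toBCF_sub_lt hτ hδ' hτt (hinf t ht)
  exact isPreconnected_Icc.subset_of_closure_inter_subset hopen
    ⟨0, Set.left_mem_Icc.2 zero_le_one, h0⟩ hclosed (Set.right_mem_Icc.2 zero_le_one)

end RHInfty

section TransferMatrix

variable {n : ℕ} {H H₁ H₂ : Matrix (Fin n) (Fin n) (RatFunc ℝ)}

/-- A transfer matrix with entries in `RH∞`, as a matrix over the ring `RH∞`. -/
def IsRHInfty.toMatrix (hH : IsRHInfty H) : Matrix (Fin n) (Fin n) rhInfty :=
  Matrix.of fun i j => ⟨H i j, hH i j⟩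

lemma map_evalHom_toMatrix (hH : IsRHInfty H) (s : ClosedRHP) :
    (evalHom s).mapMatrix hH.toMatrix = evalAt H s := rfl

lemma map_evalInftyHom_toMatrix (hH : IsRHInfty H) :
    evalInftyHom.mapMatrix hH.toMatrix = evalInfty H := rfl

lemma evalAt_conj (H : Matrix (Fin n) (Fin n) (RatFunc ℝ)) (s : ℂ) :
    evalAt H (conj s) =
      (Complex.conjAe : ℂ →ₐ[ℝ] ℂ).mapMatrix (evalAt H s) := by
  ext i j
  simp [evalAt, aeval_conj]

lemma map_det_one_add_smul_mul {R S : Type*} [CommRing R] [Algebra ℝ R] [CommRing S] [Algebra ℝ S]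
    (f : R →ₐ[ℝ] S) (t : ℝ) (A B : Matrix (Fin n) (Fin n) R) :
    f (1 + t • (B * A)).det = (1 + t • (f.mapMatrix B * f.mapMatrix A)).det := by
  rw [AlgHom.map_det, map_add, map_one, map_smul, map_mul]

lemma isUnit_det_one_add_mul (h₁ : IsRHInfty H₁) (h₂ : IsRHInfty H₂)
    (haxis : ∀ t ∈ Set.Icc (0 : ℝ) 1, ∀ ω : ℝ,
      (1 + t • (evalAt H₂ (Complex.I * ω) * evalAt H₁ (Complex.I * ω))).det ≠ 0)
    (hinf : ∀ t ∈ Set.Icc (0 : ℝ) 1, (1 + t • (evalInfty H₂ * evalInfty H₁)).det ≠ 0) :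
    IsUnit (1 + h₂.toMatrix * h₁.toMatrix).det := by
  have hunit := isUnit_of_homotopy (D := fun t => (1 + t • (h₂.toMatrix * h₁.toMatrix)).det)
    (by simp only [map_det_one_add_smul_mul]; fun_prop) (by simp)
    (fun t ht ω => by
      rw [map_det_one_add_smul_mul, map_evalHom_toMatrix, map_evalHom_toMatrix]
      exact haxis t ht ω)
    (fun t ht => by
      rw [← evalInftyHom_apply, map_det_one_add_smul_mul, map_evalInftyHom_toMatrix,
        map_evalInftyHom_toMatrix]
      exact hinf t ht)
  rwa [one_smul] at hunit

lemma det_one_add_smul_evalAt_mul_ne_zero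
    (hphase : ∀ ω : ℝ, 0 ≤ ω →
      maxPhase (evalAt H₁ (Complex.I * ω)) + maxPhase (evalAt H₂ (Complex.I * ω)) < Real.pi)
    {t : ℝ} (ht : 0 ≤ t) (ω : ℝ) :
    (1 + t • (evalAt H₂ (Complex.I * ω) * evalAt H₁ (Complex.I * ω))).det ≠ 0 := by
  rcases le_total 0 ω with hω | hω
  · exact det_one_add_smul_mul_ne_zero (hphase ω hω) ht
  · have hconj : Complex.I * ω = conj (Complex.I * (-ω : ℝ)) := by simp
    rw [hconj, evalAt_conj, evalAt_conj, ← map_det_one_add_smul_mul]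
    exact (_root_.map_ne_zero _).2
      (det_one_add_smul_mul_ne_zero (hphase (-ω) (neg_nonneg.2 hω)) ht)

theorem exists_isRHInfty_inverse_one_add (h₁ : IsRHInfty H₁) (h₂ : IsRHInfty H₂)
    (hphase : ∀ ω : ℝ, 0 ≤ ω →
      maxPhase (evalAt H₁ (Complex.I * ω)) + maxPhase (evalAt H₂ (Complex.I * ω)) < Real.pi)
    (hphase_infty : maxPhase (evalInfty H₁) + maxPhase (evalInfty H₂) < Real.pi) :
    ∃ R, IsRHInfty R ∧
      ∀ s : ℂ, 0 < s.re → (1 + evalAt H₂ s * evalAt H₁ s) * evalAt R s = 1 := by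
  obtain ⟨R, hR⟩ := ((Matrix.isUnit_iff_isUnit_det _).2 <| isUnit_det_one_add_mul h₁ h₂
    (fun t ht => det_one_add_smul_evalAt_mul_ne_zero hphase ht.1)
    (fun t ht => det_one_add_smul_mul_ne_zero hphase_infty ht.1)).exists_right_inv
  refine ⟨Matrix.of fun i j => (R i j : RatFunc ℝ), fun i j => (R i j).2, fun s hs => ?_⟩
  have h := congrArg (evalHom ⟨s, hs.le⟩).mapMatrix hR
  rwa [map_mul, map_add, map_one, map_mul] at h

end TransferMatrix

section Fourier

variable {V F : Type*} [NormedAddCommGroup V] [InnerProductSpace ℝ V] [FiniteDimensional ℝ V]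
  [MeasurableSpace V] [BorelSpace V] [NormedAddCommGroup F] [NormedSpace ℂ F] [CompleteSpace F]

theorem ae_eq_zero_of_fourier_eq_zero {g : V → F} (hg : Integrable g)
    (h : 𝓕 g = 0) : g =ᵐ[volume] 0 := by
  refine ae_eq_zero_of_integral_contDiff_smul_eq_zero hg.locallyIntegrable fun φ hφ hφc => ?_
  have hψ : HasCompactSupport fun x => (φ x : ℂ) := hφc.comp_left Complex.ofReal_zero
  let ψ : 𝓢(V, ℂ) := hψ.toSchwartzMap (Complex.ofRealCLM.contDiff.comp hφ)
  calc ∫ x, φ x • g x = ∫ x, 𝓕 (⇑(𝓕⁻ ψ : 𝓢(V, ℂ))) x • g x := by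
        rw [← SchwartzMap.fourier_coe, FourierTransform.fourier_fourierInv_eq]
        exact integral_congr_ae (ae_of_all _ fun x => (Complex.coe_smul (φ x) (g x)).symm)
    _ = ∫ x, (𝓕⁻ ψ : 𝓢(V, ℂ)) x • 𝓕 g x := by
        simpa using! VectorFourier.integral_fourierIntegral_smul_eq_flip (L := innerₗ V)
          Real.continuous_fourierChar continuous_inner (𝓕⁻ ψ : 𝓢(V, ℂ)).integrable hg
    _ = 0 := by simp only [h, Pi.zero_apply, smul_zero, integral_zero]

end Fourier

section Laplace

lemma timeMeasure_eq_restrict_Ioi : timeMeasure = volume.restrict (Set.Ioi 0) :=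
  (Measure.restrict_congr_set Ioi_ae_eq_Ici).symm

lemma integrable_exp_mul {a : ℂ} (ha : a.re < 0) :
    Integrable (fun t : ℝ => Complex.exp (a * t)) timeMeasure := by
  rw [timeMeasure_eq_restrict_Ioi]
  exact integrableOn_exp_mul_complex_Ioi ha 0

lemma integral_exp_mul {a : ℂ} (ha : a.re < 0) :
    ∫ t : ℝ, Complex.exp (a * t) ∂timeMeasure = -a⁻¹ := by
  rw [timeMeasure_eq_restrict_Ioi, integral_exp_mul_complex_Ioi ha 0]
  simp [neg_div]

lemma memLp_exp_mul {a : ℂ} (ha : a.re < 0) :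
    MemLp (fun t : ℝ => Complex.exp (a * t)) 2 timeMeasure := by
  rw [memLp_two_iff_integrable_sq_norm (by fun_prop)]
  have ha2 : (2 * a).re < 0 := by simpa using mul_neg_of_pos_of_neg two_pos ha
  refine (integrable_exp_mul ha2).norm.congr (ae_of_all _ fun t => ?_)
  simp only [← norm_pow, ← Complex.exp_nat_mul, Nat.cast_ofNat, mul_assoc]

/-- The integral defining the Laplace transform of the scalar signal `w` converges at `s`. -/
def LaplaceConvergent (w : ℝ → ℂ) (s : ℂ) : Prop :=
  Integrable (fun t : ℝ => Complex.exp (-(s * t)) * w t) timeMeasure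

/-- The Laplace transform of a scalar signal on `[0, ∞)`; it is `0` where it does not converge. -/
def scalarLaplace (w : ℝ → ℂ) (s : ℂ) : ℂ :=
  ∫ t : ℝ, Complex.exp (-(s * t)) * w t ∂timeMeasure

variable {w w₁ w₂ : ℝ → ℂ} {s : ℂ}

lemma laplaceConvergent_of_integrable (hw : Integrable w timeMeasure) (hs : 0 ≤ s.re) :
    LaplaceConvergent w s := by
  refine hw.bdd_mul (c := 1) (by fun_prop) ?_
  filter_upwards [ae_restrict_mem measurableSet_Ici] with t (ht : 0 ≤ t)
  simpa [Complex.norm_exp] using mul_nonneg hs ht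

lemma laplaceConvergent_of_memLp_two (hw : MemLp w 2 timeMeasure) (hs : 0 < s.re) :
    LaplaceConvergent w s :=
  ((memLp_exp_mul (a := -s) (by simpa using hs)).integrable_mul hw).congr
    (ae_of_all _ fun _ => by simp)

lemma scalarLaplace_const_mul (c : ℂ) (w : ℝ → ℂ) (s : ℂ) :
    scalarLaplace (fun t => c * w t) s = c * scalarLaplace w s := by
  simp only [scalarLaplace, ← integral_const_mul, mul_left_comm]

lemma scalarLaplace_add (h₁ : LaplaceConvergent w₁ s) (h₂ : LaplaceConvergent w₂ s) :
    scalarLaplace (fun t => w₁ t + w₂ t) s = scalarLaplace w₁ s + scalarLaplace w₂ s := by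
  simp only [scalarLaplace, mul_add]
  exact integral_add h₁ h₂

lemma scalarLaplace_sum {ι : Type*} (S : Finset ι) {w : ι → ℝ → ℂ}
    (h : ∀ i ∈ S, LaplaceConvergent (w i) s) :
    scalarLaplace (fun t => ∑ i ∈ S, w i t) s = ∑ i ∈ S, scalarLaplace (w i) s := by
  simp only [scalarLaplace, Finset.mul_sum]
  exact integral_finsetSum S h

lemma scalarLaplace_conj (w : ℝ → ℂ) (s : ℂ) :
    scalarLaplace (fun t => conj (w t)) s = conj (scalarLaplace w (conj s)) := by
  simp only [scalarLaplace, ← integral_conj, map_mul, ← Complex.exp_conj, map_neg,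
    Complex.conj_conj, Complex.conj_ofReal]

lemma scalarLaplace_re (h : LaplaceConvergent w s) (h' : LaplaceConvergent w (conj s)) :
    scalarLaplace (fun t => ((w t).re : ℂ)) s =
      (scalarLaplace w s + conj (scalarLaplace w (conj s))) / 2 := by
  have hconj : LaplaceConvergent (fun t => conj (w t)) s :=
    (Complex.conjCLE.toContinuousLinearMap.integrable_comp h').congr <|
      ae_of_all _ fun _ => by simp [← Complex.exp_conj]
  rw [← scalarLaplace_conj, ← scalarLaplace_add h hconj, div_eq_inv_mul,
    ← scalarLaplace_const_mul]
  congr 1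
  funext t
  rw [Complex.re_eq_add_conj, div_eq_inv_mul]

lemma scalarLaplace_exp {r : ℂ} (hrs : r.re < s.re) :
    scalarLaplace (fun t => Complex.exp (r * t)) s = (s - r)⁻¹ := by
  have hre : (r - s).re < 0 := by rwa [Complex.sub_re, sub_neg]
  rw [← neg_sub r s, inv_neg, ← integral_exp_mul hre, scalarLaplace]
  congr 1
  funext t
  rw [← Complex.exp_add]
  congr 1
  ring

lemma exp_mul_posConvolution (s : ℂ) (k w : ℝ → ℂ) (t : ℝ) :
    Complex.exp (-(s * t)) * posConvolution k w (ContinuousLinearMap.mul ℝ ℂ) volume t =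
      posConvolution (fun x : ℝ => Complex.exp (-(s * x)) * k x)
        (fun x : ℝ => Complex.exp (-(s * x)) * w x) (ContinuousLinearMap.mul ℝ ℂ) volume t := by
  simp only [posConvolution, Set.indicator_apply, mul_ite, mul_zero,
    ContinuousLinearMap.mul_apply', ← intervalIntegral.integral_const_mul]
  refine if_congr Iff.rfl (intervalIntegral.integral_congr fun x _ => ?_) rfl
  have hexp : Complex.exp (-(s * t)) =
      Complex.exp (-(s * x)) * Complex.exp (-(s * (t - x : ℝ))) := by
    rw [← Complex.exp_add]
    push_cast
    ring_nf
  rw [hexp]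
  ring

lemma scalarLaplace_posConvolution {k : ℝ → ℂ} (hk : LaplaceConvergent k s)
    (hw : LaplaceConvergent w s) :
    scalarLaplace (posConvolution k w (ContinuousLinearMap.mul ℝ ℂ) volume) s =
      scalarLaplace k s * scalarLaplace w s := by
  rw [LaplaceConvergent, timeMeasure_eq_restrict_Ioi] at hk hw
  have := integral_posConvolution hk hw (ContinuousLinearMap.mul ℝ ℂ)
  simp only [scalarLaplace, exp_mul_posConvolution, timeMeasure_eq_restrict_Ioi]
  rw [← ContinuousLinearMap.mul_apply' ℝ, ← this]
  refine setIntegral_congr_fun measurableSet_Ioi fun t ht => ?_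
  simp only [posConvolution, Set.indicator_of_mem ht]

theorem ae_eq_zero_of_scalarLaplace_eq_zero (hw : MemLp w 2 timeMeasure)
    (h : ∀ s : ℂ, 0 < s.re → scalarLaplace w s = 0) : w =ᵐ[timeMeasure] 0 := by
  set g : ℝ → ℂ := (Set.Ici 0).indicator fun t : ℝ => Complex.exp (-(1 * t)) * w t with hg
  have hgi : Integrable g := (integrable_indicator_iff measurableSet_Ici).2
    (laplaceConvergent_of_memLp_two hw (s := 1) one_pos)
  -- The Fourier transform of `t ↦ e^{-t} w(t)` is `ŵ` on the line `re s = 1`.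
  have hfourier : 𝓕 g = 0 := by
    funext ω
    rw [Real.fourier_real_eq_integral_exp_smul, Pi.zero_apply,
      ← h (1 + 2 * Real.pi * ω * Complex.I) (by simp), scalarLaplace, timeMeasure,
      ← integral_indicator measurableSet_Ici]
    congr 1
    funext t
    by_cases ht : t ∈ Set.Ici (0 : ℝ)
    · rw [hg, Set.indicator_of_mem ht, Set.indicator_of_mem ht, smul_eq_mul, ← mul_assoc,
        ← Complex.exp_add]
      congr 2
      push_cast
      ring
    · rw [hg, Set.indicator_of_notMem ht, Set.indicator_of_notMem ht, smul_zero]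
  filter_upwards [ae_restrict_of_ae (ae_eq_zero_of_fourier_eq_zero hgi hfourier),
    ae_restrict_mem measurableSet_Ici] with t ht ht0
  rw [hg, Set.indicator_of_mem ht0] at ht
  exact (mul_eq_zero.1 ht).resolve_left (Complex.exp_ne_zero _)

end Laplace

section WienerAlgebra

/-- The open right half plane. -/
abbrev OpenRHP : Type := {s : ℂ // 0 < s.re}

/-- The half plane Wiener algebra: the functions `d + k̂` with `d` constant and `k̂` the Laplace
transform of an integrable kernel `k`. These are the transfer functions of the convolution operators
`w ↦ d w + k * w`, which are bounded on `L₂` by Young's inequality. -/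
def wienerAlgebra : Subalgebra ℂ (OpenRHP → ℂ) where
  carrier := {g | ∃ (d : ℂ) (k : ℝ → ℂ), Integrable k timeMeasure ∧
    ∀ s : OpenRHP, g s = d + scalarLaplace k s}
  add_mem' := by
    rintro _ _ ⟨d₁, k₁, hk₁, h₁⟩ ⟨d₂, k₂, hk₂, h₂⟩
    refine ⟨d₁ + d₂, fun t => k₁ t + k₂ t, hk₁.add hk₂, fun s => ?_⟩
    rw [Pi.add_apply, h₁, h₂, scalarLaplace_add (laplaceConvergent_of_integrable hk₁ s.2.le)
      (laplaceConvergent_of_integrable hk₂ s.2.le)]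
    ring
  mul_mem' := by
    rintro _ _ ⟨d₁, k₁, hk₁, h₁⟩ ⟨d₂, k₂, hk₂, h₂⟩
    set k := posConvolution k₁ k₂ (ContinuousLinearMap.mul ℝ ℂ)
    have hk : Integrable k timeMeasure := by
      rw [timeMeasure_eq_restrict_Ioi] at hk₁ hk₂ ⊢
      exact (integrable_posConvolution hk₁ hk₂ _).restrict
    have hd₂ : Integrable (fun t => d₁ * k₂ t) timeMeasure := hk₂.const_mul d₁
    have hd₁ : Integrable (fun t => d₂ * k₁ t) timeMeasure := hk₁.const_mul d₂
    have hd : Integrable (fun t => d₁ * k₂ t + d₂ * k₁ t) timeMeasure := hd₂.add hd₁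
    refine ⟨d₁ * d₂, fun t => d₁ * k₂ t + d₂ * k₁ t + k t, hd.add hk, fun s => ?_⟩
    have hL {w : ℝ → ℂ} (hw : Integrable w timeMeasure) : LaplaceConvergent w s :=
      laplaceConvergent_of_integrable hw s.2.le
    rw [Pi.mul_apply, h₁, h₂, scalarLaplace_add (hL hd) (hL hk),
      scalarLaplace_add (hL hd₂) (hL hd₁), scalarLaplace_const_mul, scalarLaplace_const_mul,
      scalarLaplace_posConvolution (hL hk₁) (hL hk₂)]
    ring
  algebraMap_mem' d := ⟨d, 0, integrable_zero _ _ _, fun _ => by simp [scalarLaplace]⟩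

lemma inv_sub_mem_wienerAlgebra {r : ℂ} (hr : r.re < 0) :
    (fun s : OpenRHP => ((s : ℂ) - r)⁻¹) ∈ wienerAlgebra :=
  ⟨0, fun t => Complex.exp (r * t), integrable_exp_mul hr, fun s => by
    rw [zero_add, scalarLaplace_exp (hr.trans s.2)]⟩

lemma eval_div_prod_sub_mem_wienerAlgebra (S : Multiset ℂ) (hS : ∀ r ∈ S, r.re < 0) (p : ℂ[X])
    (hp : p.natDegree ≤ S.card) :
    (fun s : OpenRHP => p.eval (s : ℂ) / (S.map fun r => (s : ℂ) - r).prod) ∈ wienerAlgebra := by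
  induction S using Multiset.induction generalizing p with
  | empty =>
    rw [eq_C_of_natDegree_le_zero (p := p) (by simpa using hp)]
    simpa only [Multiset.map_zero, Multiset.prod_zero, div_one, eval_C]
      using! wienerAlgebra.algebraMap_mem (p.coeff 0)
  | cons r S ih =>
    have hS' : ∀ x ∈ S, x.re < 0 := fun x hx => hS x (Multiset.mem_cons_of_mem hx)
    have hquot := ih hS' (p /ₘ (X - C r)) (by
      rw [natDegree_divByMonic _ (monic_X_sub_C r), natDegree_X_sub_C]
      rw [Multiset.card_cons] at hp
      omega)
    have hrem := ih hS' (C (p.eval r)) (by simp)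
    have hr := inv_sub_mem_wienerAlgebra (hS r (Multiset.mem_cons_self r S))
    convert add_mem hquot (mul_mem hr hrem) using 1
    funext s
    have hne : ∀ x : ℂ, x.re < 0 → (s : ℂ) - x ≠ 0 := fun x hx =>
      sub_ne_zero.2 fun h => (hx.trans s.2).ne (congrArg Complex.re h.symm)
    have hsr := hne r (hS r (Multiset.mem_cons_self r S))
    -- `p = p(r) + (X - r) q` splits `p / ((s - r) ∏)` into `q / ∏` and `(s - r)⁻¹ (p(r) / ∏)`.
    have hdiv := congrArg (eval (s : ℂ)) (modByMonic_add_div p (X - C r))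
    rw [modByMonic_X_sub_C_eq_C_eval, eval_add, eval_mul, eval_sub, eval_X, eval_C, eval_C] at hdiv
    simp only [Multiset.map_cons, Multiset.prod_cons, Pi.add_apply, Pi.mul_apply, eval_C, ← hdiv]
    field_simp
    ring

lemma aeval_eq_leadingCoeff_mul_prod_roots (p : ℝ[X]) (s : ℂ) :
    aeval s p = (p.leadingCoeff : ℂ) *
      ((p.map (algebraMap ℝ ℂ)).roots.map fun r => s - r).prod := by
  rw [← eval_map_algebraMap, (IsAlgClosed.splits (p.map (algebraMap ℝ ℂ))).eval_eq_prod_roots,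
    leadingCoeff_map]
  rfl

lemma aeval_div_aeval_mem_wienerAlgebra {p q : ℝ[X]} (hpq : p.natDegree ≤ q.natDegree)
    (hq : ∀ s : ℂ, 0 ≤ s.re → aeval s q ≠ 0) :
    (fun s : OpenRHP => aeval (s : ℂ) p / aeval (s : ℂ) q) ∈ wienerAlgebra := by
  have hroots : ∀ r ∈ (q.map (algebraMap ℝ ℂ)).roots, r.re < 0 := fun r hr => by
    by_contra! h
    have hr0 := (mem_roots'.1 hr).2
    rw [IsRoot, eval_map_algebraMap] at hr0
    exact hq r h hr0
  have hcard : (p.map (algebraMap ℝ ℂ)).natDegree ≤ (q.map (algebraMap ℝ ℂ)).roots.card := by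
    rwa [← (IsAlgClosed.splits (q.map (algebraMap ℝ ℂ))).natDegree_eq_card_roots, natDegree_map,
      natDegree_map]
  convert mul_mem (wienerAlgebra.algebraMap_mem (q.leadingCoeff : ℂ)⁻¹)
    (eval_div_prod_sub_mem_wienerAlgebra _ hroots _ hcard) using 1
  funext s
  rw [aeval_eq_leadingCoeff_mul_prod_roots q, ← eval_map_algebraMap, div_mul_eq_div_div_swap,
    div_eq_inv_mul]
  rfl

lemma exists_real_kernel_of_mem_wienerAlgebra {g : ℂ → ℂ}
    (hg : (fun s : OpenRHP => g s) ∈ wienerAlgebra)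
    (hconj : ∀ s : ℂ, 0 < s.re → g (conj s) = conj (g s)) :
    ∃ (d : ℝ) (k : ℝ → ℝ), Integrable k timeMeasure ∧
      ∀ s : ℂ, 0 < s.re → g s = d + scalarLaplace (fun t => (k t : ℂ)) s := by
  obtain ⟨d, k, hk, h⟩ := hg
  dsimp only at h
  refine ⟨d.re, fun t => (k t).re, hk.re, fun s hs => ?_⟩
  have hs' : 0 < (conj s).re := by rwa [Complex.conj_re]
  rw [scalarLaplace_re (laplaceConvergent_of_integrable hk hs.le)
    (laplaceConvergent_of_integrable hk hs'.le), Complex.re_eq_add_conj, ← add_div,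
    eq_div_iff two_ne_zero]
  calc g s * 2 = g s + conj (g (conj s)) := by rw [hconj s hs, Complex.conj_conj, mul_two]
    _ = _ := by rw [h ⟨s, hs⟩, h ⟨conj s, hs'⟩, map_add]; ring

lemma exists_real_kernel_of_mem_rhInfty {f : RatFunc ℝ} (hf : f ∈ rhInfty) :
    ∃ (d : ℝ) (k : ℝ → ℝ), Integrable k timeMeasure ∧
      ∀ s : ℂ, 0 < s.re →
        aeval s f.num / aeval s f.denom = d + scalarLaplace (fun t => (k t : ℂ)) s :=
  exists_real_kernel_of_mem_wienerAlgebra (aeval_div_aeval_mem_wienerAlgebra hf.1 hf.2)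
    fun s _ => by rw [aeval_conj, aeval_conj, map_div₀]

end WienerAlgebra

section Young

lemma sq_lintegral_mul_le {α : Type*} [MeasurableSpace α] {μ : Measure α} {f g : α → ℝ≥0∞}
    (hf : AEMeasurable f μ) (hg : AEMeasurable g μ) :
    (∫⁻ x, f x * g x ∂μ) ^ 2 ≤ (∫⁻ x, f x ^ 2 * g x ∂μ) * ∫⁻ x, g x ∂μ := by
  have hsq : ∀ a : ℝ≥0∞, (a ^ (2⁻¹ : ℝ)) ^ 2 = a := fun a => by
    rw [← ENNReal.rpow_two, ENNReal.rpow_inv_rpow two_ne_zero]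
  have hfactor : ∀ x, f x * g x = (f x ^ 2 * g x) ^ (2⁻¹ : ℝ) * g x ^ (2⁻¹ : ℝ) := fun x => by
    rw [ENNReal.mul_rpow_of_nonneg _ _ (by norm_num), ← ENNReal.rpow_two,
      ENNReal.rpow_rpow_inv two_ne_zero, mul_assoc, ← sq, hsq]
  calc (∫⁻ x, f x * g x ∂μ) ^ 2
      ≤ ((∫⁻ x, f x ^ 2 * g x ∂μ) ^ (2⁻¹ : ℝ) * (∫⁻ x, g x ∂μ) ^ (2⁻¹ : ℝ)) ^ 2 := by
        simp only [hfactor]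
        gcongr
        exact ENNReal.lintegral_mul_norm_pow_le ((hf.pow_const 2).mul hg) hg (by norm_num)
          (by norm_num) (by norm_num)
    _ = (∫⁻ x, f x ^ 2 * g x ∂μ) * ∫⁻ x, g x ∂μ := by rw [mul_pow, hsq, hsq]

lemma eLpNorm_two_sq {α E : Type*} [MeasurableSpace α] [NormedAddCommGroup E] (u : α → E)
    (μ : Measure α) : eLpNorm u 2 μ ^ 2 = ∫⁻ x, ‖u x‖ₑ ^ 2 ∂μ := by
  simpa using eLpNorm_nnreal_pow_eq_lintegral (f := u) (μ := μ) (p := 2) two_ne_zero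

variable {G : Type*} [MeasurableSpace G] [AddCommGroup G] [MeasurableAdd₂ G] [MeasurableNeg G]
  {μ : Measure G} [SFinite μ] [μ.IsAddLeftInvariant] [μ.IsNegInvariant]

lemma lintegral_sq_lintegral_mul_sub_le {f g : G → ℝ≥0∞} (hf : AEMeasurable f μ)
    (hg : AEMeasurable g μ) :
    ∫⁻ t, (∫⁻ x, f x * g (t - x) ∂μ) ^ 2 ∂μ ≤ (∫⁻ x, g x ∂μ) ^ 2 * ∫⁻ x, f x ^ 2 ∂μ := by
  have hleft (t : G) : AEMeasurable (fun x => g (t - x)) μ :=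
    hg.comp_quasiMeasurePreserving (quasiMeasurePreserving_sub_left μ t)
  have hright (x : G) : AEMeasurable (fun t => g (t - x)) μ :=
    hg.comp_quasiMeasurePreserving (measurePreserving_sub_right μ x).quasiMeasurePreserving
  have hmeas : AEMeasurable (Function.uncurry fun t x : G => f x ^ 2 * g (t - x)) (μ.prod μ) :=
    (hf.comp_snd.pow_const 2).mul <|
      hg.comp_quasiMeasurePreserving (quasiMeasurePreserving_sub_of_right_invariant μ μ)
  have hinner : AEMeasurable (fun t => ∫⁻ x, f x ^ 2 * g (t - x) ∂μ) μ :=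
    hmeas.lintegral_prod_right'
  calc ∫⁻ t, (∫⁻ x, f x * g (t - x) ∂μ) ^ 2 ∂μ
      ≤ ∫⁻ t, (∫⁻ x, f x ^ 2 * g (t - x) ∂μ) * ∫⁻ x, g x ∂μ ∂μ := by
        refine lintegral_mono fun t => (sq_lintegral_mul_le hf (hleft t)).trans_eq ?_
        rw [lintegral_sub_left_eq_self g t]
    _ = (∫⁻ x, ∫⁻ t, f x ^ 2 * g (t - x) ∂μ ∂μ) * ∫⁻ x, g x ∂μ := by
        rw [lintegral_mul_const'' _ hinner, lintegral_lintegral_swap hmeas]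
    _ = (∫⁻ x, f x ^ 2 * ∫⁻ t, g t ∂μ ∂μ) * ∫⁻ x, g x ∂μ := by
        congr 2 with x
        rw [lintegral_const_mul'' _ (hright x), lintegral_sub_right_eq_self g x]
    _ = (∫⁻ x, g x ∂μ) ^ 2 * ∫⁻ x, f x ^ 2 ∂μ := by
        rw [lintegral_mul_const'' _ (hf.pow_const 2)]
        ring

variable {E E' F : Type*} [NormedAddCommGroup E] [NormedAddCommGroup E'] [NormedAddCommGroup F]
  [NormedSpace ℝ E] [NormedSpace ℝ E'] [NormedSpace ℝ F]

theorem eLpNorm_two_convolution_le (L : E →L[ℝ] E' →L[ℝ] F) {u : G → E} {k : G → E'}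
    (hu : AEStronglyMeasurable u μ) (hk : AEStronglyMeasurable k μ) :
    eLpNorm (convolution u k L μ) 2 μ ≤ ‖L‖ₑ * (∫⁻ x, ‖k x‖ₑ ∂μ) * eLpNorm u 2 μ := by
  have hpt (t : G) : ‖convolution u k L μ t‖ₑ ≤ ‖L‖ₑ * ∫⁻ x, ‖u x‖ₑ * ‖k (t - x)‖ₑ ∂μ := by
    rw [← lintegral_const_mul' _ _ enorm_ne_top]
    refine (enorm_integral_le_lintegral_enorm _).trans (lintegral_mono fun x => ?_)
    calc ‖L (u x) (k (t - x))‖ₑ ≤ ‖L (u x)‖ₑ * ‖k (t - x)‖ₑ := (L (u x)).le_opENorm _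
      _ ≤ ‖L‖ₑ * (‖u x‖ₑ * ‖k (t - x)‖ₑ) := by
        rw [← mul_assoc]
        gcongr
        exact L.le_opENorm _
  refine (ENNReal.pow_le_pow_left_iff two_ne_zero).1 ?_
  calc eLpNorm (convolution u k L μ) 2 μ ^ 2
      ≤ ∫⁻ t, ‖L‖ₑ ^ 2 * (∫⁻ x, ‖u x‖ₑ * ‖k (t - x)‖ₑ ∂μ) ^ 2 ∂μ := by
        rw [eLpNorm_two_sq]
        refine lintegral_mono fun t => ?_
        rw [← mul_pow]
        gcongr
        exact hpt t
    _ ≤ ‖L‖ₑ ^ 2 * ((∫⁻ x, ‖k x‖ₑ ∂μ) ^ 2 * ∫⁻ x, ‖u x‖ₑ ^ 2 ∂μ) := by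
        rw [lintegral_const_mul' _ _ (ENNReal.pow_ne_top enorm_ne_top)]
        gcongr
        exact lintegral_sq_lintegral_mul_sub_le hu.enorm hk.enorm
    _ = (‖L‖ₑ * (∫⁻ x, ‖k x‖ₑ ∂μ) * eLpNorm u 2 μ) ^ 2 := by
        rw [mul_pow, mul_pow, eLpNorm_two_sq, mul_assoc]

end Young

section CausalBounded

variable {E F G : Type*} [NormedAddCommGroup E] [NormedAddCommGroup F] [NormedAddCommGroup G]

lemma ae_timeMeasure_iff_forall {p : ℝ → Prop} :
    (∀ᵐ t ∂timeMeasure, p t) ↔ ∀ T : ℝ, ∀ᵐ t ∂volume.restrict (Set.Icc 0 T), p t := by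
  refine ⟨fun h T => ae_mono (Measure.restrict_mono_set _ Set.Icc_subset_Ici_self) h, fun h => ?_⟩
  have hIci : Set.Ici (0 : ℝ) = ⋃ k : ℕ, Set.Icc (0 : ℝ) k := by
    ext t
    simp [exists_nat_ge]
  rw [timeMeasure, hIci, ae_restrict_iUnion_iff]
  exact fun k => h k

/-- An operator on signals which is causal (up to null sets) and bounded on `L₂`. Nothing is
required of signals which are not square integrable, apart from causality. -/
structure IsCausalBounded (Φ : (ℝ → E) → ℝ → F) : Prop where
  causal : ∀ {T : ℝ} {u v : ℝ → E}, u =ᵐ[volume.restrict (Set.Icc 0 T)] v →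
    Φ u =ᵐ[volume.restrict (Set.Icc 0 T)] Φ v
  bounded : ∃ C : ℝ≥0, ∀ {u : ℝ → E}, MemLp u 2 timeMeasure → MemLp (Φ u) 2 timeMeasure ∧
    eLpNorm (Φ u) 2 timeMeasure ≤ C * eLpNorm u 2 timeMeasure

namespace IsCausalBounded

variable {Φ Φ' : (ℝ → E) → ℝ → F} {Ψ : (ℝ → F) → ℝ → G} {u v : ℝ → E}

lemma memLp (h : IsCausalBounded Φ) (hu : MemLp u 2 timeMeasure) : MemLp (Φ u) 2 timeMeasure :=
  h.bounded.elim fun _ hC => (hC hu).1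

lemma congr_ae (h : IsCausalBounded Φ) (huv : u =ᵐ[timeMeasure] v) : Φ u =ᵐ[timeMeasure] Φ v :=
  ae_timeMeasure_iff_forall.2 fun T => h.causal (ae_timeMeasure_iff_forall.1 huv T)

lemma comp (hΨ : IsCausalBounded Ψ) (hΦ : IsCausalBounded Φ) :
    IsCausalBounded fun u => Ψ (Φ u) := by
  obtain ⟨C, hC⟩ := hΦ.bounded
  obtain ⟨D, hD⟩ := hΨ.bounded
  refine ⟨fun huv => hΨ.causal (hΦ.causal huv), D * C, fun hu => ⟨(hD (hC hu).1).1, ?_⟩⟩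
  rw [ENNReal.coe_mul, mul_assoc]
  exact (hD (hC hu).1).2.trans (by gcongr; exact (hC hu).2)

lemma add (h : IsCausalBounded Φ) (h' : IsCausalBounded Φ') :
    IsCausalBounded fun u t => Φ u t + Φ' u t := by
  obtain ⟨C, hC⟩ := h.bounded
  obtain ⟨C', hC'⟩ := h'.bounded
  refine ⟨fun huv => (h.causal huv).add (h'.causal huv), C + C', fun hu =>
    ⟨(hC hu).1.add (hC' hu).1, ?_⟩⟩
  rw [ENNReal.coe_add, add_mul]
  exact (eLpNorm_add_le (hC hu).1.1 (hC' hu).1.1 one_le_two).trans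
    (add_le_add (hC hu).2 (hC' hu).2)

lemma clm {𝕜 : Type*} [NontriviallyNormedField 𝕜] [NormedSpace 𝕜 E] [NormedSpace 𝕜 F]
    (A : E →L[𝕜] F) : IsCausalBounded fun (u : ℝ → E) t => A (u t) where
  causal huv := huv.fun_comp A
  bounded := ⟨‖A‖₊, fun hu => ⟨A.comp_memLp' hu,
    eLpNorm_le_nnreal_smul_eLpNorm_of_ae_le_mul (ae_of_all _ fun _ => A.le_opNNNorm _) 2⟩⟩

lemma sum {ι : Type*} {Φ : ι → (ℝ → E) → ℝ → F} (S : Finset ι)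
    (h : ∀ i, IsCausalBounded (Φ i)) : IsCausalBounded fun u t => ∑ i ∈ S, Φ i u t := by
  classical
  induction S using Finset.induction_on with
  | empty => exact ⟨fun _ => by simp, 0, by simp⟩
  | insert i S hi ih => simpa only [Finset.sum_insert hi] using (h i).add ih

end IsCausalBounded

lemma isCausalBounded_posConvolution [NormedSpace ℝ E] [NormedSpace ℝ F] [NormedSpace ℝ G]
    (L : E →L[ℝ] F →L[ℝ] G) {k : ℝ → F} (hk : Integrable k timeMeasure) :
    IsCausalBounded fun u => posConvolution u k L volume where
  causal {T u v} huv := by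
    filter_upwards [ae_restrict_mem measurableSet_Icc] with t ht
    simp only [posConvolution, Set.indicator_apply]
    congr 1
    refine intervalIntegral.integral_congr_ae ?_
    filter_upwards [(ae_restrict_iff' measurableSet_Icc).1 huv] with x hx hxt
    rw [Set.uIoc_of_le ht.1] at hxt
    rw [hx ⟨hxt.1.le, hxt.2.trans ht.2⟩]
  bounded := by
    simp only [timeMeasure_eq_restrict_Ioi] at hk ⊢
    replace hk := (integrable_indicator_iff measurableSet_Ioi).2 hk
    refine ⟨(‖L‖ₑ * ∫⁻ x, ‖(Set.Ioi 0).indicator k x‖ₑ).toNNReal, fun {u} hu => ?_⟩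
    have hu' := ((memLp_indicator_iff_restrict measurableSet_Ioi).2 hu).1
    have hle : eLpNorm (posConvolution u k L volume) 2 (volume.restrict (Set.Ioi 0)) ≤
        (‖L‖ₑ * ∫⁻ x, ‖(Set.Ioi 0).indicator k x‖ₑ) *
          eLpNorm u 2 (volume.restrict (Set.Ioi 0)) := by
      rw [← eLpNorm_indicator_eq_eLpNorm_restrict (f := u) measurableSet_Ioi,
        posConvolution_eq_convolution_indicator _ _ L volume]
      exact (eLpNorm_mono_measure _ Measure.restrict_le_self).trans
        (eLpNorm_two_convolution_le L hu' hk.1)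
    have hfin : ‖L‖ₑ * ∫⁻ x, ‖(Set.Ioi 0).indicator k x‖ₑ ≠ ∞ :=
      ENNReal.mul_ne_top enorm_ne_top hk.2.ne
    rw [ENNReal.coe_toNNReal hfin]
    refine ⟨⟨?_, hle.trans_lt (ENNReal.mul_lt_top hfin.lt_top hu.2)⟩, hle⟩
    rw [posConvolution_eq_convolution_indicator _ _ L volume]
    exact (hu'.convolution_integrand L hk.1).integral_prod_right'.restrict

end CausalBounded

section ScalarOperator

variable {𝕜 : Type*} [RCLike 𝕜]

/-- The inclusion of `𝕜 = ℝ, ℂ` in `ℂ`, through which `laplace` is defined. Being isometric, it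
commutes with integrals whether or not these converge. -/
def toComplexLI (𝕜 : Type*) [RCLike 𝕜] : 𝕜 →ₗᵢ[ℝ] ℂ where
  toLinearMap := (RCLike.map 𝕜 ℂ).toLinearMap
  norm_map' z := by
    refine (sq_eq_sq₀ (norm_nonneg _) (norm_nonneg _)).1 ?_
    rw [RCLike.norm_sq_eq_def, RCLike.norm_sq_eq_def]
    simp

lemma toComplexLI_posConvolution (u : ℝ → 𝕜) (k : ℝ → ℝ) :
    (fun t => toComplexLI 𝕜 (posConvolution u k (ContinuousLinearMap.lsmul ℝ ℝ).flip volume t)) =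
      posConvolution (fun t => toComplexLI 𝕜 (u t)) (fun t => (k t : ℂ))
        (ContinuousLinearMap.mul ℝ ℂ) volume := by
  funext t
  simp only [posConvolution, Set.indicator_apply]
  split_ifs
  · rw [← LinearIsometry.intervalIntegral_comp_comm]
    simp [mul_comm]
  · exact map_zero _

lemma laplaceConvergent_toComplexLI {u : ℝ → 𝕜} (hu : MemLp u 2 timeMeasure) {s : ℂ}
    (hs : 0 < s.re) : LaplaceConvergent (fun t => toComplexLI 𝕜 (u t)) s :=
  laplaceConvergent_of_memLp_two ((toComplexLI 𝕜).toContinuousLinearMap.comp_memLp' hu) hs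

/-- Causal convolution with the measure `d δ₀ + k(t) dt`: the system with direct feedthrough `d`
and convolution kernel `k`. -/
def convolutionOperator (d : ℝ) (k : ℝ → ℝ) (u : ℝ → 𝕜) (t : ℝ) : 𝕜 :=
  d • u t + posConvolution u k (ContinuousLinearMap.lsmul ℝ ℝ).flip volume t

variable {k : ℝ → ℝ} (d : ℝ)

lemma isCausalBounded_convolutionOperator (hk : Integrable k timeMeasure) :
    IsCausalBounded (convolutionOperator (𝕜 := 𝕜) d k) :=
  (IsCausalBounded.clm (d • ContinuousLinearMap.id ℝ 𝕜)).add (isCausalBounded_posConvolution _ hk)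

lemma scalarLaplace_convolutionOperator (hk : Integrable k timeMeasure) {u : ℝ → 𝕜}
    (hu : MemLp u 2 timeMeasure) {s : ℂ} (hs : 0 < s.re) :
    scalarLaplace (fun t => toComplexLI 𝕜 (convolutionOperator d k u t)) s =
      (d + scalarLaplace (fun t => (k t : ℂ)) s) *
        scalarLaplace (fun t => toComplexLI 𝕜 (u t)) s := by
  have hfeed : LaplaceConvergent (fun t => toComplexLI 𝕜 (d • u t)) s :=
    laplaceConvergent_toComplexLI (hu.const_smul d) hs
  have hkernel : LaplaceConvergent (fun t => (k t : ℂ)) s :=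
    laplaceConvergent_of_integrable hk.ofReal hs.le
  have hconv := laplaceConvergent_toComplexLI
    ((isCausalBounded_posConvolution (ContinuousLinearMap.lsmul ℝ ℝ).flip hk).memLp hu) hs
  simp only [convolutionOperator, map_add]
  rw [scalarLaplace_add hfeed hconv, toComplexLI_posConvolution,
    scalarLaplace_posConvolution (laplaceConvergent_toComplexLI hu hs) hkernel]
  simp only [map_smul, Complex.real_smul]
  rw [scalarLaplace_const_mul]
  ring

end ScalarOperator

section TransferFunction

variable {𝕜 : Type*} [RCLike 𝕜] {n : ℕ} {u v : ℝ → EuclideanSpace 𝕜 (Fin n)}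

lemma IsL2e.congr_ae (hu : IsL2e u) (h : u =ᵐ[timeMeasure] v) : IsL2e v := fun T =>
  (hu T).ae_eq (ae_timeMeasure_iff_forall.1 h T)

lemma IsL2.isL2e (hu : IsL2 u) : IsL2e u := fun _ =>
  hu.mono_measure (Measure.restrict_mono_set _ Set.Icc_subset_Ici_self)

lemma IsL2e.isL2_truncate (hu : IsL2e u) (T : ℝ) : IsL2 (truncate T u) := by
  rw [IsL2, truncate, memLp_indicator_iff_restrict measurableSet_Icc, timeMeasure,
    Measure.restrict_restrict_of_subset Set.Icc_subset_Ici_self]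
  exact hu T

lemma truncate_ae_eq (T : ℝ) (u : ℝ → EuclideanSpace 𝕜 (Fin n)) :
    truncate T u =ᵐ[volume.restrict (Set.Icc 0 T)] u :=
  indicator_ae_eq_restrict measurableSet_Icc

lemma laplace_apply (u : ℝ → EuclideanSpace 𝕜 (Fin n)) (s : ℂ) (i : Fin n) :
    laplace u s i = scalarLaplace (fun t => toComplexLI 𝕜 (u t i)) s := rfl

lemma IsL2.memLp_apply (hu : IsL2 u) (i : Fin n) : MemLp (fun t => u t i) 2 timeMeasure :=
  (EuclideanSpace.proj (𝕜 := 𝕜) i).comp_memLp' hu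

lemma laplace_add (hu : IsL2 u) (hv : IsL2 v) {s : ℂ} (hs : 0 < s.re) :
    laplace (fun t => u t + v t) s = laplace u s + laplace v s := by
  funext i
  simp only [Pi.add_apply, laplace_apply, PiLp.add_apply, map_add]
  exact scalarLaplace_add (laplaceConvergent_toComplexLI (hu.memLp_apply i) hs)
    (laplaceConvergent_toComplexLI (hv.memLp_apply i) hs)

theorem ae_eq_of_laplace_eq (hu : IsL2 u) (hv : IsL2 v)
    (h : ∀ s : ℂ, 0 < s.re → laplace u s = laplace v s) : u =ᵐ[timeMeasure] v := by
  have hcoord (i : Fin n) : (fun t => toComplexLI 𝕜 ((u t - v t) i)) =ᵐ[timeMeasure] 0 := by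
    refine ae_eq_zero_of_scalarLaplace_eq_zero ((toComplexLI 𝕜).toContinuousLinearMap.comp_memLp'
      (IsL2.memLp_apply (hu.sub hv) i)) fun s hs => ?_
    have hadd := laplace_add (hu.sub hv) hv hs
    simp only [Pi.sub_apply, sub_add_cancel] at hadd
    exact congrFun (right_eq_add.1 ((h s hs).symm.trans hadd)) i
  filter_upwards [ae_all_iff.2 hcoord] with t ht
  ext i
  exact sub_eq_zero.1 ((map_eq_zero_iff _ (toComplexLI 𝕜).injective).1 (ht i))

/-- `Φ` is a causal operator, bounded on `L₂`, which acts on `L₂` by multiplication of Laplace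
transforms by `M` in the open right half plane. -/
structure HasTransferFunction (M : ℂ → Matrix (Fin n) (Fin n) ℂ)
    (Φ : (ℝ → EuclideanSpace 𝕜 (Fin n)) → ℝ → EuclideanSpace 𝕜 (Fin n)) : Prop
    extends IsCausalBounded Φ where
  laplace_eq : ∀ {u : ℝ → EuclideanSpace 𝕜 (Fin n)}, IsL2 u → ∀ {s : ℂ}, 0 < s.re →
    laplace (Φ u) s = (M s).mulVec (laplace u s)

namespace HasTransferFunction

variable {M N : ℂ → Matrix (Fin n) (Fin n) ℂ} {H : Matrix (Fin n) (Fin n) (RatFunc ℝ)}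
  {Φ Ψ : (ℝ → EuclideanSpace 𝕜 (Fin n)) → ℝ → EuclideanSpace 𝕜 (Fin n)}

lemma isL2e (h : HasTransferFunction M Φ) (hu : IsL2e u) : IsL2e (Φ u) := fun T =>
  ((IsL2.isL2e (h.memLp (hu.isL2_truncate T))) T).ae_eq (h.causal (truncate_ae_eq T u))

lemma id : HasTransferFunction 1 fun u : ℝ → EuclideanSpace 𝕜 (Fin n) => u where
  toIsCausalBounded := .clm (.id 𝕜 _)
  laplace_eq _ _ _ := (Matrix.one_mulVec _).symm

lemma add (h : HasTransferFunction M Φ) (h' : HasTransferFunction N Ψ) :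
    HasTransferFunction (M + N) fun u t => Φ u t + Ψ u t where
  toIsCausalBounded := h.toIsCausalBounded.add h'.toIsCausalBounded
  laplace_eq hu s hs := by
    rw [laplace_add (h.memLp hu) (h'.memLp hu) hs, h.laplace_eq hu hs, h'.laplace_eq hu hs,
      ← Matrix.add_mulVec, Pi.add_apply]

lemma comp (h : HasTransferFunction M Φ) (h' : HasTransferFunction N Ψ) :
    HasTransferFunction (M * N) fun u => Φ (Ψ u) where
  toIsCausalBounded := h.toIsCausalBounded.comp h'.toIsCausalBounded
  laplace_eq hu s hs := by
    rw [h.laplace_eq (h'.memLp hu) hs, h'.laplace_eq hu hs, Matrix.mulVec_mulVec, Pi.mul_apply]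

lemma ae_eq (h : HasTransferFunction M Φ) (h' : HasTransferFunction N Ψ)
    (hMN : ∀ s : ℂ, 0 < s.re → M s = N s) (hu : IsL2e u) : Φ u =ᵐ[timeMeasure] Ψ u := by
  refine ae_timeMeasure_iff_forall.2 fun T => ?_
  have huT := hu.isL2_truncate T
  have htrunc : Φ (truncate T u) =ᵐ[timeMeasure] Ψ (truncate T u) :=
    ae_eq_of_laplace_eq (h.memLp huT) (h'.memLp huT) fun s hs => by
      rw [h.laplace_eq huT hs, h'.laplace_eq huT hs, hMN s hs]
  exact (h.causal (truncate_ae_eq T u)).symm.trans <|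
    EventuallyEq.trans (ae_timeMeasure_iff_forall.1 htrunc T) (h'.causal (truncate_ae_eq T u))

lemma isResponse_iff (h : HasTransferFunction (evalAt H) Φ) (hu : IsL2e u) :
    IsResponse H u v ↔ v =ᵐ[timeMeasure] Φ u := by
  have hΦ (T : ℝ) : IsL2Response H (truncate T u) (Φ (truncate T u)) :=
    ⟨h.memLp (hu.isL2_truncate T), fun _ hs => h.laplace_eq (hu.isL2_truncate T) hs⟩
  refine ⟨fun hv => ae_timeMeasure_iff_forall.2 fun T => ?_, fun hv T => ⟨_, hΦ T, ?_⟩⟩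
  · obtain ⟨z, ⟨hz, hzs⟩, hvz⟩ := hv T
    have hzΦ : z =ᵐ[timeMeasure] Φ (truncate T u) :=
      ae_eq_of_laplace_eq hz (hΦ T).1 fun s hs => (hzs s hs).trans ((hΦ T).2 s hs).symm
    exact (hvz.trans (ae_timeMeasure_iff_forall.1 hzΦ T)).trans (h.causal (truncate_ae_eq T u))
  · exact EventuallyEq.trans (ae_timeMeasure_iff_forall.1 hv T)
      (h.causal (truncate_ae_eq T u)).symm

end HasTransferFunction

theorem IsRHInfty.exists_hasTransferFunction {H : Matrix (Fin n) (Fin n) (RatFunc ℝ)}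
    (hH : IsRHInfty H) : ∃ Φ : (ℝ → EuclideanSpace 𝕜 (Fin n)) → ℝ → EuclideanSpace 𝕜 (Fin n),
      HasTransferFunction (evalAt H) Φ := by
  choose d k hk hkernel using fun i j => exists_real_kernel_of_mem_rhInfty (hH i j)
  have hentry (i j : Fin n) : IsCausalBounded fun u : ℝ → EuclideanSpace 𝕜 (Fin n) =>
      convolutionOperator (d i j) (k i j) fun t => u t j :=
    (isCausalBounded_convolutionOperator _ (hk i j)).comp (.clm (EuclideanSpace.proj (𝕜 := 𝕜) j))
  refine ⟨fun u t => ∑ i, ∑ j,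
    convolutionOperator (d i j) (k i j) (fun x => u x j) t • EuclideanSpace.single i (1 : 𝕜),
    .sum _ fun i => .sum _ fun j => (IsCausalBounded.clm (ContinuousLinearMap.toSpanSingleton 𝕜
      (EuclideanSpace.single i (1 : 𝕜)))).comp (hentry i j), fun {u} hu {s} hs => ?_⟩
  funext i
  have hsum (t : ℝ) : toComplexLI 𝕜 ((∑ i, ∑ j, convolutionOperator (d i j) (k i j)
      (fun x => u x j) t • EuclideanSpace.single i (1 : 𝕜) : EuclideanSpace 𝕜 (Fin n)) i) =
      ∑ j, toComplexLI 𝕜 (convolutionOperator (d i j) (k i j) (fun x => u x j) t) := by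
    simp [Pi.single_apply]
  simp only [laplace_apply, hsum]
  rw [scalarLaplace_sum _ fun j _ => laplaceConvergent_toComplexLI ((hentry i j).memLp hu) hs]
  refine Finset.sum_congr rfl fun j _ => ?_
  rw [scalarLaplace_convolutionOperator _ (hk i j) (hu.memLp_apply j) hs, ← hkernel i j s hs]
  rfl

end TransferFunction

section FeedbackLoop

variable {𝕜 : Type*} [RCLike 𝕜] {n : ℕ} {u e y : ℝ → EuclideanSpace 𝕜 (Fin n)}
  {H₁ H₂ R : Matrix (Fin n) (Fin n) (RatFunc ℝ)}
  {Φ₁ Φ₂ Ψ : (ℝ → EuclideanSpace 𝕜 (Fin n)) → ℝ → EuclideanSpace 𝕜 (Fin n)}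

lemma isLoopSolution_iff_returnDifference (h₁ : HasTransferFunction (evalAt H₁) Φ₁)
    (h₂ : HasTransferFunction (evalAt H₂) Φ₂) :
    IsLoopSolution H₁ H₂ u e y ↔
      IsL2e e ∧ (fun t => e t + Φ₂ (Φ₁ e) t) =ᵐ[timeMeasure] u ∧ y =ᵐ[timeMeasure] Φ₁ e := by
  constructor
  · rintro ⟨he, hy, hye, w, -, hwy, heq⟩
    rw [h₁.isResponse_iff he] at hye
    rw [h₂.isResponse_iff hy] at hwy
    refine ⟨he, ?_, hye⟩
    filter_upwards [heq, hwy, h₂.congr_ae hye] with t ht hwt hyt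
    rw [← hyt, ← hwt, ht, sub_add_cancel]
  · rintro ⟨he, heu, hye⟩
    have hy : IsL2e y := (h₁.isL2e he).congr_ae hye.symm
    refine ⟨he, hy, (h₁.isResponse_iff he).2 hye, Φ₂ y, h₂.isL2e hy,
      (h₂.isResponse_iff hy).2 .rfl, ?_⟩
    filter_upwards [heu, h₂.congr_ae hye] with t ht hyt
    rw [hyt, ← ht, add_sub_cancel_right]

variable (h₁ : HasTransferFunction (evalAt H₁) Φ₁) (h₂ : HasTransferFunction (evalAt H₂) Φ₂)
  (hΨ : HasTransferFunction (evalAt R) Ψ)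
  (hR : ∀ s : ℂ, 0 < s.re → (1 + evalAt H₂ s * evalAt H₁ s) * evalAt R s = 1)
include h₁ h₂ hΨ hR

lemma isLoopSolution_iff (hu : IsL2e u) :
    IsLoopSolution H₁ H₂ u e y ↔ e =ᵐ[timeMeasure] Ψ u ∧ y =ᵐ[timeMeasure] Φ₁ (Ψ u) := by
  have hreturn := HasTransferFunction.id.add (h₂.comp h₁)
  rw [isLoopSolution_iff_returnDifference h₁ h₂]
  constructor
  · rintro ⟨he, heu, hye⟩
    have hleft := (hΨ.comp hreturn).ae_eq .id (fun s hs => mul_eq_one_comm.1 (hR s hs)) he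
    have heΨ : e =ᵐ[timeMeasure] Ψ u := hleft.symm.trans (hΨ.congr_ae heu)
    exact ⟨heΨ, hye.trans (h₁.congr_ae heΨ)⟩
  · rintro ⟨heΨ, hyΨ⟩
    have hright := (hreturn.comp hΨ).ae_eq .id hR hu
    exact ⟨(hΨ.isL2e hu).congr_ae heΨ.symm, (hreturn.congr_ae heΨ).trans hright,
      hyΨ.trans (h₁.congr_ae heΨ.symm)⟩

theorem isL2Stable_of_returnDifference_inverse : IsL2Stable 𝕜 H₁ H₂ where
  exists_solution u hu :=
    ⟨Ψ u, Φ₁ (Ψ u), (isLoopSolution_iff h₁ h₂ hΨ hR hu).2 ⟨.rfl, .rfl⟩⟩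
  unique_solution u e y e' y' hu h h' := by
    rw [isLoopSolution_iff h₁ h₂ hΨ hR hu] at h h'
    exact ⟨h.1.trans h'.1.symm, h.2.trans h'.2.symm⟩
  finite_gain := by
    obtain ⟨C, hC⟩ := hΨ.bounded
    obtain ⟨C', hC'⟩ := (h₁.comp hΨ).bounded
    refine ⟨max C C', fun u e y hu h => ?_⟩
    obtain ⟨he, hy⟩ := (isLoopSolution_iff h₁ h₂ hΨ hR hu.isL2e).1 h
    rw [IsL2, IsL2, memLp_congr_ae he, memLp_congr_ae hy, eLpNorm_congr_ae he, eLpNorm_congr_ae hy]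
    refine ⟨(hC hu).1, (hC' hu).1, (hC hu).2.trans ?_, (hC' hu).2.trans ?_⟩
    · gcongr
      exact le_max_left _ _
    · gcongr
      exact le_max_right _ _

end FeedbackLoop

end SmallPhase

end

theorem theorem3 (𝕜 : Type*) [RCLike 𝕜] (n : ℕ)
    (H₁ H₂ : Matrix (Fin n) (Fin n) (RatFunc ℝ))
    (hH₁ : SmallPhase.IsRHInfty H₁) (hH₂ : SmallPhase.IsRHInfty H₂)
    (hphase : ∀ ω : ℝ, 0 ≤ ω →
      SmallPhase.maxPhase (SmallPhase.evalAt H₁ (Complex.I * (ω : ℂ))) +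
        SmallPhase.maxPhase (SmallPhase.evalAt H₂ (Complex.I * (ω : ℂ))) < Real.pi)
    (hphase_infty : SmallPhase.maxPhase (SmallPhase.evalInfty H₁) +
        SmallPhase.maxPhase (SmallPhase.evalInfty H₂) < Real.pi) :
    SmallPhase.IsL2Stable 𝕜 H₁ H₂ := by
  obtain ⟨R, hR, hinverse⟩ :=
    SmallPhase.exists_isRHInfty_inverse_one_add hH₁ hH₂ hphase hphase_infty
  obtain ⟨Φ₁, hΦ₁⟩ := hH₁.exists_hasTransferFunction (𝕜 := 𝕜)
  obtain ⟨Φ₂, hΦ₂⟩ := hH₂.exists_hasTransferFunction (𝕜 := 𝕜)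
  obtain ⟨Ψ, hΨ⟩ := hR.exists_hasTransferFunction (𝕜 := 𝕜)
  exact SmallPhase.isL2Stable_of_returnDifference_inverse hΦ₁ hΦ₂ hΨ hinverse
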